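/- Fix $a\in(-1,1)$ and $\sigma_a(x)=x$ for $x\ge 0$, $\sigma_a(x)=ax$ for $x<0$. A network of depth $L\ge1$ with widths $n_0=d_{in},n_1,\dots,n_{L-1},n_L=d_{out}$ and parameters $\mathbf W=(W_1,b_1,\dots,W_L,b_L)$ represents the function $f_{\mathbf W}(x)=\tilde\alpha_L(x)$, where $\alpha_0(x)=x$, $\tilde\alpha_\ell(x)=W_\ell\alpha_{\ell-1}(x)+b_\ell$ and $\alpha_\ell(x)=\sigma_a(\tilde\alpha_\ell(x))$ entrywise; $\|\mathbf W\|^2=\sum_\ell(\|W_\ell\|_F^2+\|b_\ell\|^2)$. For $\Omega\subset\mathbb R^{d_{in}}$, let $R(f;\Omega,\sigma_a,L)\in[0,\infty]$ be the infimum of $\|\mathbf W\|^2$ over all networks of depth $L$, of any finite hidden widths, with $f_{\mathbf W}=f$ on $\Omega$ ($\infty$ if there are none). A finite piecewise linear function is a function $\mathbb R^d\to\mathbb R^e$ that is affine on each of finitely many closed polyhedra covering $\mathbb R^d$. $\mathrm{Rank}_{BN}(f;\Omega)$ is the smallest $k\in\mathbb N$ such that $f=h\circ g$ on $\Omega$ for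 finite piecewise linear functions $g:\mathbb R^{d_{in}}\to\mathbb R^k$ and $h:\mathbb R^k\to\mathbb R^{d_{out}}$. Let $\Omega\subset\mathbb R^{d_{in}}$ be bounded and let $f^*:\mathbb R^{d_{in}}\to\mathbb R^{d_{out}}$ be finite piecewise linear with $\mathrm{Rank}_{BN}(f^*;\Omega)=k$. Then there are a constant $C\ge0$, a depth $L_0$ and a width $m$, depending only on $f^*$, $\Omega$ and $a$, such that the following holds for every depth $L\geq 1$ with $L\ge L_0$ or $R(f^*;\Omega,\sigma_a,L)<\infty$. (i) $\frac1L R(f^*;\Omega,\sigma_a,L)\le k+\frac CL$. (ii) Let $N\ge1$, $x_1,\dots,x_N\in\Omega$, $\lambda>0$, let $n_1,\dots,n_{L-1}$ be hidden widths, and let $\hat{\mathbf W}$ be any global minimum, over the parameters of the depth-$L$ network with these widths, of $$\mathcal L_\lambda(\mathbf W)=\frac1N\sum_{i=1}^N\|f_{\mathbf W}(x_i)-f^*(x_i)\|^2+\frac\lambda L\|\mathbf W\|^2 .$$ If $n_\ell\ge m$ for all $1\le\ell\le L-1$, then $$\frac1L R(f_{\hat{\mathbf W}};\Omega,\sigma_a,L)\le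 k+\frac CL .$$ If $n_\ell\ge N(N+1)$ for all $1\le\ell\le L-1$, or if the infimum $R(f^*;\Omega,\sigma_a,L)$ is attained by a network whose $\ell$-th hidden width is at most $n_\ell$ for every $\ell$, then $$\frac1L R(f_{\hat{\mathbf W}};\Omega,\sigma_a,L)\le\frac1L R(f^*;\Omega,\sigma_a,L)\le k+\frac CL .$$ -/

import Mathlib

open scoped ENNReal NNReal

/-- The homogeneous nonlinearity `σ_a`: the identity on `[0, ∞)` and `x ↦ a x` on `(-∞, 0)`. -/
noncomputable def homAct (a x : ℝ) : ℝ := if 0 ≤ x then x else a * x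

/-- Squared Euclidean norm of a vector. -/
def sqNorm {d : ℕ} (v : Fin d → ℝ) : ℝ := ∑ i, v i ^ 2

/-- Squared Frobenius norm of a matrix. -/
def sqFrob {m n : ℕ} (A : Matrix (Fin m) (Fin n) ℝ) : ℝ := ∑ i, ∑ j, A i j ^ 2

/-- Parameters `(W₁, b₁, …, W_L, b_L)` of a fully connected network with input dimension `din`,
list `ns = [n₁, …, n_{L-1}]` of hidden widths and output dimension `dout`. The depth (the number
of weight matrices) is `L = ns.length + 1`. -/
inductive Network : ℕ → List ℕ → ℕ → Type
  /-- The last (affine) layer. -/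
  | output {din dout : ℕ} (A : Matrix (Fin dout) (Fin din) ℝ) (b : Fin dout → ℝ) :
      Network din [] dout
  /-- A first layer of width `n`, followed by the remaining layers. -/
  | hidden {din n dout : ℕ} {ns : List ℕ} (A : Matrix (Fin n) (Fin din) ℝ) (b : Fin n → ℝ)
      (rest : Network n ns dout) : Network din (n :: ns) dout

namespace Network

/-- The network function `f_W`: the nonlinearity is applied entrywise after each hidden layer, and
the value is the vector of pre-activations of the last layer. -/
noncomputable def eval (a : ℝ) : {din : ℕ} → {ns : List ℕ} → {dout : ℕ} →
    Network din ns dout → (Fin din → ℝ) → (Fin dout → ℝ)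
  | _, _, _, output A b, x => A.mulVec x + b
  | _, _, _, hidden A b rest, x => rest.eval a (fun i => homAct a ((A.mulVec x + b) i))

/-- The squared norm `‖W‖²` of all the parameters (weights and biases). -/
def normSq : {din : ℕ} → {ns : List ℕ} → {dout : ℕ} → Network din ns dout → ℝ
  | _, _, _, output A b => sqFrob A + sqNorm b
  | _, _, _, hidden A b rest => sqFrob A + sqNorm b + rest.normSq

/-- The regularized mean squared error of depth `L = ns.length + 1`,
`(1/N) ∑ᵢ ‖f_W(xᵢ) - f(xᵢ)‖² + (lam/L) ‖W‖²`, for outputs generated by `f`. -/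
noncomputable def loss (a lam : ℝ) {din dout N : ℕ} (x : Fin N → (Fin din → ℝ))
    (f : (Fin din → ℝ) → (Fin dout → ℝ)) {ns : List ℕ} (W : Network din ns dout) : ℝ :=
  (1 / (N : ℝ)) * ∑ i, sqNorm (W.eval a (x i) - f (x i))
    + (lam / ((ns.length + 1 : ℕ) : ℝ)) * W.normSq

/-- `W` is a global minimum of the loss among all networks with the same widths. -/
def IsGlobalMin (a lam : ℝ) {din dout N : ℕ} (x : Fin N → (Fin din → ℝ))
    (f : (Fin din → ℝ) → (Fin dout → ℝ)) {ns : List ℕ} (W : Network din ns dout) : Prop :=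
  ∀ V : Network din ns dout, W.loss a lam x f ≤ V.loss a lam x f

end Network

/-- The representation cost `R(f; Ω, σ_a, L)`: the infimum of `‖W‖²` over all networks of depth `L`,
of any finite widths, with `f_W = f` on `Ω`; it is `∞` if there is no such network. -/
noncomputable def reprCost (a : ℝ) (L : ℕ) {din dout : ℕ} (Ω : Set (Fin din → ℝ))
    (f : (Fin din → ℝ) → (Fin dout → ℝ)) : ℝ≥0∞ :=
  ⨅ (ns : List ℕ) (_ : ns.length + 1 = L) (W : Network din ns dout)
    (_ : Set.EqOn (W.eval a) f Ω), ENNReal.ofReal W.normSq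

/-- The minimum in the representation cost of `f` is attained by a network of the same depth
whose hidden widths are at most `ns`. -/
def CostAttainedWithin (a : ℝ) {din dout : ℕ} (Ω : Set (Fin din → ℝ))
    (f : (Fin din → ℝ) → (Fin dout → ℝ)) (ns : List ℕ) : Prop :=
  ∃ (ns' : List ℕ) (V : Network din ns' dout), List.Forall₂ (· ≤ ·) ns' ns ∧
    Set.EqOn (V.eval a) f Ω ∧ ENNReal.ofReal V.normSq = reprCost a (ns.length + 1) Ω f

/-- A closed convex polyhedron: a finite intersection of closed half-spaces. -/
def IsPolyhedron {d : ℕ} (P : Set (Fin d → ℝ)) : Prop :=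
  ∃ (r : ℕ) (φ : Fin r → ((Fin d → ℝ) →ₗ[ℝ] ℝ)) (c : Fin r → ℝ), P = {x | ∀ j, φ j x ≤ c j}

/-- Finite piecewise linear functions: the space is a finite union of closed polyhedra on each of
which `f` is affine (such an `f` is automatically continuous). -/
def IsFPLF {d e : ℕ} (f : (Fin d → ℝ) → (Fin e → ℝ)) : Prop :=
  ∃ (r : ℕ) (P : Fin r → Set (Fin d → ℝ)), (∀ i, IsPolyhedron (P i)) ∧
    (⋃ i, P i) = Set.univ ∧
    ∀ i, ∃ A : (Fin d → ℝ) →ᵃ[ℝ] (Fin e → ℝ), Set.EqOn f A (P i)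

/-- The bottleneck rank `Rank_BN(f; Ω)`: the smallest `k` such that `f = h ∘ g` on `Ω` for finite
piecewise linear functions `g`, `h` with inner dimension `k`. -/
noncomputable def rankBN {d e : ℕ} (Ω : Set (Fin d → ℝ)) (f : (Fin d → ℝ) → (Fin e → ℝ)) : ℕ :=
  sInf {k : ℕ | ∃ (g : (Fin d → ℝ) → (Fin k → ℝ)) (h : (Fin k → ℝ) → (Fin e → ℝ)),
    IsFPLF g ∧ IsFPLF h ∧ Set.EqOn f (h ∘ g) Ω}

/-!
On the bounded set `Ω`, a constant shift moves the values of any continuous map into the nonnegative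
orthant, where `σ_a` is the identity. For `a ≠ 1` one more layer can then compute the maximum of two
functions while passing everything else through, so the max-min formula for continuous piecewise
linear functions turns them into networks. Writing `f = h ∘ g` through `ℝᵏ` and shifting `g`, the
layers inserted between `g` and `h` may be identity matrices, of squared norm `k` each, so depth `L`
costs at most `k L + C` at bounded width. The finitely many smaller depths only enlarge `C` and the
width.

A global minimum costs no more than any interpolating network that fits into its widths. A narrower
network fits after padding with zeros. A wider one can first be narrowed: only the Gram matrix of
the hidden activations at the `N` data points matters for the later layers, and by homogeneity a
unit scaled by `√c` contributes `c` times as much to this Gram matrix and to the squared norm of the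
layer. By Carathéodory's theorem for cones, `N ^ 2 + 1` rescaled units suffice to preserve both.
-/

section ContinuousSelection

open Filter Topology

theorem eventually_forall_eq_imp_eq {ι X Y : Type*} [Finite ι] [TopologicalSpace X]
    [TopologicalSpace Y] [T2Space Y] {f : X → Y} {ℓ : ι → X → Y} (hf : Continuous f)
    (hℓ : ∀ j, Continuous (ℓ j)) (x : X) : ∀ᶠ y in 𝓝 x, ∀ j, f y = ℓ j y → f x = ℓ j x := by
  refine eventually_all.2 fun j => ?_
  by_cases hj : f x = ℓ j x
  · exact .of_forall fun _ _ => hj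
  · filter_upwards [(isOpen_ne_fun hf (hℓ j)).mem_nhds hj] with y hy hy' using absurd hy' hy

theorem nonneg_one_of_continuous_selection {ι : Type*} [Finite ι] {α β : ι → ℝ} {φ : ℝ → ℝ}
    (hφ : Continuous φ) (hsel : ∀ t, ∃ j, φ t = α j + β j * t) (h₀ : 0 ≤ φ 0)
    (h : ∀ j, 0 ≤ α j → 0 ≤ α j + β j) : 0 ≤ φ 1 := by
  suffices key : Set.Icc (0 : ℝ) 1 ⊆ {t | 0 ≤ φ t} from key ⟨zero_le_one, le_rfl⟩
  refine IsClosed.Icc_subset_of_forall_exists_gt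
    ((isClosed_le continuous_const hφ).inter isClosed_Icc) h₀ ?_
  rintro t ⟨ht : 0 ≤ φ t, ht₀, ht₁⟩ y hy
  have hactive : ∀ᶠ z in 𝓝 t, ∀ j, φ z = α j + β j * z → φ t = α j + β j * t :=
    eventually_forall_eq_imp_eq hφ (ℓ := fun j z => α j + β j * z) (fun j => by fun_prop) t
  obtain ⟨z, hz, htz, hzy⟩ :=
    ((hactive.filter_mono nhdsWithin_le_nhds).and (Ioc_mem_nhdsGT (lt_min hy ht₁))).exists
  obtain ⟨hzy, hz₁⟩ := le_min_iff.1 hzy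
  obtain ⟨j, hj⟩ := hsel z
  have htj : 0 ≤ α j + β j * t := hz j hj ▸ ht
  refine ⟨z, ?_, htz, hzy⟩
  change 0 ≤ φ z
  rw [hj]
  -- Either the line active at `z` is nonnegative at `0` and `1`, or it increases beyond `t < z`.
  rcases le_or_gt 0 (α j) with hα | hα
  · nlinarith [h j hα]
  · have hβ : 0 < β j := pos_of_mul_pos_left (by linarith : 0 < β j * t) ht₀
    linarith [mul_nonneg hβ.le (sub_nonneg.2 htz.le)]

variable {ι E : Type*} [AddCommGroup E] [Module ℝ E] [TopologicalSpace E]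
  [IsTopologicalAddGroup E] [ContinuousSMul ℝ E] {ℓ : ι → E →ᵃ[ℝ] ℝ} {f : E → ℝ}

theorem le_of_continuous_selection [Finite ι] (hf : Continuous f) (hsel : ∀ x, ∃ j, f x = ℓ j x)
    {x y : E} {c : ℝ} (h : ∀ j, f y ≤ ℓ j y → c ≤ ℓ j x) : c ≤ f x := by
  have hline : ∀ j t, ℓ j (AffineMap.lineMap y x t) = ℓ j y + (ℓ j x - ℓ j y) * t := by
    intro j t
    rw [AffineMap.apply_lineMap, AffineMap.lineMap_apply_ring']
    ring
  have hone := nonneg_one_of_continuous_selection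
    (α := fun j => ℓ j y - f y) (β := fun j => (ℓ j x - ℓ j y) - (c - f y))
    (φ := fun t => f (AffineMap.lineMap y x t) - (f y + (c - f y) * t))
    ((hf.comp AffineMap.lineMap_continuous).sub (by fun_prop))
    (fun t => by
      obtain ⟨j, hj⟩ := hsel (AffineMap.lineMap y x t)
      exact ⟨j, by rw [hj, hline]; ring⟩)
    (by simp)
    (fun j hj => by linarith [h j (by linarith)])
  simpa using hone

/-- The max-min representation: `f` is the maximum over `y` of the minimum of the pieces `ℓ j` with
`f y ≤ ℓ j y`, and only finitely many sets of pieces occur. -/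
theorem mem_latticeClosure_of_continuous_selection [Finite ι] (hf : Continuous f)
    (hsel : ∀ x, ∃ j, f x = ℓ j x) : f ∈ latticeClosure (Set.range fun j => ⇑(ℓ j)) := by
  classical
  have := Fintype.ofFinite ι
  let above : E → Finset ι := fun y => {j | f y ≤ ℓ j y}
  have habove : ∀ y, (above y).Nonempty := fun y => (hsel y).imp fun j hj => by simp [above, hj]
  let m : E → E → ℝ := fun y => (above y).inf' (habove y) fun j => ⇑(ℓ j)
  have hm_le : ∀ y x, m y x ≤ f x := fun y x =>
    le_of_continuous_selection hf hsel fun j hj =>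
      Finset.inf'_le (fun j => ⇑(ℓ j)) (by simpa [above] using hj) x
  have hle_m : ∀ y x, above y = above x → f x ≤ m y x := fun y x hyx => by
    simp only [m, Finset.inf'_apply]
    refine Finset.le_inf' _ _ fun j hj => ?_
    rw [hyx] at hj
    simpa [above] using hj
  have hf_eq : f = Finset.univ.sup' Finset.univ_nonempty fun s => m (Function.invFun above s) := by
    ext x
    rw [Finset.sup'_apply]
    refine le_antisymm ?_ (Finset.sup'_le _ _ fun s _ => hm_le _ x)
    exact (hle_m _ x (Function.invFun_eq ⟨x, rfl⟩)).trans
      (Finset.le_sup' (fun s => m (Function.invFun above s) x) (Finset.mem_univ (above x)))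
  rw [hf_eq]
  exact isSublattice_latticeClosure.supClosed.finsetSup'_mem _ fun s _ =>
    isSublattice_latticeClosure.infClosed.finsetInf'_mem _ fun j _ =>
      subset_latticeClosure ⟨j, rfl⟩

end ContinuousSelection

section ConicCaratheodory

variable {𝕜 E ι : Type*} [Field 𝕜] [LinearOrder 𝕜] [IsStrictOrderedRing 𝕜] [AddCommGroup E]
  [Module 𝕜 E] {v : ι → E}

theorem exists_pos_relation_of_not_linearIndepOn {s : Finset ι} (hs : ¬ LinearIndepOn 𝕜 v s) :
    ∃ g : ι → 𝕜, ∑ i ∈ s, g i • v i = 0 ∧ ∃ i ∈ s, 0 < g i := by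
  rw [linearIndepOn_finset_iff] at hs
  push Not at hs
  obtain ⟨g, hg, i, hi, hgi⟩ := hs
  rcases hgi.lt_or_gt with hneg | hpos
  · exact ⟨-g, by simp [hg], i, hi, by simpa using hneg⟩
  · exact ⟨g, hg, i, hi, hpos⟩

theorem exists_conic_combination_erase [DecidableEq ι] {s : Finset ι}
    (hs : ¬ LinearIndepOn 𝕜 v s) {c : ι → 𝕜} (hc : ∀ i ∈ s, 0 ≤ c i) :
    ∃ i₀ ∈ s, ∃ c' : ι → 𝕜, (∀ i ∈ s.erase i₀, 0 ≤ c' i) ∧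
      ∑ i ∈ s.erase i₀, c' i • v i = ∑ i ∈ s, c i • v i := by
  obtain ⟨g, hg, i₁, hi₁, hgi₁⟩ := exists_pos_relation_of_not_linearIndepOn hs
  obtain ⟨i₀, hi₀, hmin⟩ := (s.filter fun i => 0 < g i).exists_min_image (fun i => c i / g i)
    ⟨i₁, by simp [hi₁, hgi₁]⟩
  obtain ⟨hi₀s, hg₀⟩ := Finset.mem_filter.1 hi₀
  refine ⟨i₀, hi₀s, fun i => c i - c i₀ / g i₀ * g i, fun i hi => ?_, ?_⟩
  · have his := Finset.mem_of_mem_erase hi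
    rcases le_or_gt (g i) 0 with hgi | hgi
    · have := mul_nonpos_of_nonneg_of_nonpos (div_nonneg (hc i₀ hi₀s) hg₀.le) hgi
      linarith [hc i his]
    · exact sub_nonneg.2 ((le_div_iff₀ hgi).1 (hmin i (by simp [his, hgi])))
  · rw [Finset.sum_erase _ (by simp [hg₀.ne'])]
    simp only [sub_smul, mul_smul, Finset.sum_sub_distrib, ← Finset.smul_sum, hg, smul_zero,
      sub_zero]

theorem exists_conic_combination_linearIndepOn (s : Finset ι) {c : ι → 𝕜}
    (hc : ∀ i ∈ s, 0 ≤ c i) :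
    ∃ t ⊆ s, ∃ c' : ι → 𝕜, LinearIndepOn 𝕜 v t ∧ (∀ i ∈ t, 0 ≤ c' i) ∧
      ∑ i ∈ t, c' i • v i = ∑ i ∈ s, c i • v i := by
  classical
  induction s using Finset.strongInduction generalizing c with
  | H s ih =>
    by_cases hs : LinearIndepOn 𝕜 v s
    · exact ⟨s, subset_rfl, c, hs, hc, rfl⟩
    obtain ⟨i₀, hi₀, c₁, hc₁, hsum₁⟩ := exists_conic_combination_erase hs hc
    obtain ⟨t, ht, c', hind, hc', hsum⟩ := ih _ (Finset.erase_ssubset hi₀) hc₁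
    exact ⟨t, ht.trans (Finset.erase_subset _ _), c', hind, hc', hsum.trans hsum₁⟩

theorem exists_conic_combination_le_finrank [Fintype ι] [FiniteDimensional 𝕜 E] (v : ι → E) :
    ∃ m ≤ Module.finrank 𝕜 E, ∃ (e : Fin m → ι) (c : Fin m → 𝕜),
      (∀ j, 0 ≤ c j) ∧ ∑ j, c j • v (e j) = ∑ i, v i := by
  obtain ⟨t, -, c, hind, hc, hsum⟩ := exists_conic_combination_linearIndepOn (v := v)
    Finset.univ (c := (1 : ι → 𝕜)) fun _ _ => zero_le_one
  refine ⟨t.card, by simpa using hind.fintype_card_le_finrank, fun j => t.equivFin.symm j,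
    fun j => c (t.equivFin.symm j), fun j => hc _ (t.equivFin.symm j).2, ?_⟩
  rw [Equiv.sum_comp t.equivFin.symm fun i : t => c i • v i,
    Finset.sum_coe_sort t fun i => c i • v i, hsum]
  simp only [Pi.one_apply, one_smul]

end ConicCaratheodory

section Gram

variable {𝕜 ι E F : Type*} [RCLike 𝕜] [NormedAddCommGroup E] [InnerProductSpace 𝕜 E]
  [NormedAddCommGroup F] [InnerProductSpace 𝕜 F] {u : ι → E} {v : ι → F}

theorem inner_linearCombination_eq_of_gram_eq
    (h : ∀ i j, inner 𝕜 (v i) (v j) = inner 𝕜 (u i) (u j)) (c d : ι →₀ 𝕜) :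
    inner 𝕜 (Finsupp.linearCombination 𝕜 v c) (Finsupp.linearCombination 𝕜 v d) =
      inner 𝕜 (Finsupp.linearCombination 𝕜 u c) (Finsupp.linearCombination 𝕜 u d) := by
  simp only [Finsupp.linearCombination_apply, Finsupp.sum_inner, Finsupp.inner_sum,
    inner_smul_left, inner_smul_right, h]

theorem exists_inner_eq_of_gram_eq [(Submodule.span 𝕜 (Set.range u)).HasOrthogonalProjection]
    (h : ∀ i j, inner 𝕜 (v i) (v j) = inner 𝕜 (u i) (u j)) (w : E) :
    ∃ w' : F, ‖w'‖ ≤ ‖w‖ ∧ ∀ i, inner 𝕜 w' (v i) = inner 𝕜 w (u i) := by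
  let K := Submodule.span 𝕜 (Set.range u)
  obtain ⟨c, hc⟩ := (Finsupp.mem_span_range_iff_exists_finsupp).1
    (K.starProjection_apply_mem w : K.starProjection w ∈ K)
  change Finsupp.linearCombination 𝕜 u c = _ at hc
  have hinner := inner_linearCombination_eq_of_gram_eq h c
  refine ⟨Finsupp.linearCombination 𝕜 v c, ?_, fun i => ?_⟩
  · have hnorm : ‖Finsupp.linearCombination 𝕜 v c‖ = ‖K.starProjection w‖ := by
      rw [@norm_eq_sqrt_re_inner 𝕜, @norm_eq_sqrt_re_inner 𝕜, hinner, hc]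
    exact hnorm.trans_le (K.norm_starProjection_apply_le w)
  · have hproj := K.starProjection_inner_eq_zero w (u i) (Submodule.subset_span ⟨i, rfl⟩)
    rw [inner_sub_left, sub_eq_zero] at hproj
    simpa [hc, hproj] using hinner (Finsupp.single i 1)

end Gram

section Activation

theorem homAct_eq (a x : ℝ) : homAct a x = a * x + (1 - a) * max x 0 := by
  unfold homAct
  split_ifs with hx
  · rw [max_eq_left hx]; ring
  · rw [max_eq_right (not_le.1 hx).le]; ring

theorem homAct_of_nonneg (a : ℝ) {x : ℝ} (hx : 0 ≤ x) : homAct a x = x := if_pos hx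

theorem homAct_zero (a : ℝ) : homAct a 0 = 0 := homAct_of_nonneg a le_rfl

theorem homAct_mul_of_nonneg (a : ℝ) {c : ℝ} (hc : 0 ≤ c) (x : ℝ) :
    homAct a (c * x) = c * homAct a x := by
  have hmax : max (c * x) 0 = c * max x 0 := by rw [mul_max_of_nonneg x 0 hc, mul_zero]
  rw [homAct_eq, homAct_eq, hmax]
  ring

theorem continuous_homAct (a : ℝ) : Continuous (homAct a) := by
  rw [funext (homAct_eq a)]
  fun_prop

theorem sup_eq_add_homAct {a : ℝ} (ha : a ≠ 1) (x y : ℝ) :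
    x ⊔ y = y + (1 - a)⁻¹ * (homAct a (x - y) - a * (x - y)) := by
  have ha' : 1 - a ≠ 0 := sub_ne_zero.2 ha.symm
  have hmax : x ⊔ y = y + max (x - y) 0 := by rw [← max_add_add_left]; simp
  rw [homAct_eq, add_sub_cancel_left, inv_mul_cancel_left₀ ha', hmax]

end Activation

section SquaredNorms

theorem sqNorm_eq_dotProduct {d : ℕ} (v : Fin d → ℝ) : sqNorm v = v ⬝ᵥ v := by
  simp only [sqNorm, dotProduct, sq]

theorem sqNorm_nonneg {d : ℕ} (v : Fin d → ℝ) : 0 ≤ sqNorm v :=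
  Finset.sum_nonneg fun _ _ => sq_nonneg _

theorem sqNorm_zero (d : ℕ) : sqNorm (0 : Fin d → ℝ) = 0 := by
  simp [sqNorm]

theorem sqNorm_smul {d : ℕ} (c : ℝ) (v : Fin d → ℝ) : sqNorm (c • v) = c ^ 2 * sqNorm v := by
  simp only [sqNorm, Pi.smul_apply, smul_eq_mul, mul_pow, Finset.mul_sum]

theorem sqFrob_eq_sum_sqNorm {m n : ℕ} (A : Matrix (Fin m) (Fin n) ℝ) :
    sqFrob A = ∑ i, sqNorm (A i) := rfl

theorem sqFrob_nonneg {m n : ℕ} (A : Matrix (Fin m) (Fin n) ℝ) : 0 ≤ sqFrob A :=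
  Finset.sum_nonneg fun i _ => sqNorm_nonneg (A i)

theorem sqFrob_one (d : ℕ) : sqFrob (1 : Matrix (Fin d) (Fin d) ℝ) = d := by
  simp [sqFrob, Matrix.one_apply, ite_pow]

end SquaredNorms

section GramDotProduct

variable {ι : Type*} {n n' : ℕ} {u : ι → Fin n → ℝ} {v : ι → Fin n' → ℝ}

theorem exists_dotProduct_eq_of_gram_eq (h : ∀ i j, v i ⬝ᵥ v j = u i ⬝ᵥ u j) (w : Fin n → ℝ) :
    ∃ w' : Fin n' → ℝ, sqNorm w' ≤ sqNorm w ∧ ∀ i, w' ⬝ᵥ v i = w ⬝ᵥ u i := by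
  have hinner : ∀ {m : ℕ} (y z : EuclideanSpace ℝ (Fin m)), inner ℝ y z = y.ofLp ⬝ᵥ z.ofLp :=
    fun y z => by rw [dotProduct_comm, EuclideanSpace.inner_eq_star_dotProduct, star_trivial]
  have hsq : ∀ {m : ℕ} (y : EuclideanSpace ℝ (Fin m)), sqNorm y.ofLp = ‖y‖ ^ 2 := fun y => by
    rw [sqNorm_eq_dotProduct, ← hinner, real_inner_self_eq_norm_sq]
  obtain ⟨w', hw', hw'v⟩ := exists_inner_eq_of_gram_eq (𝕜 := ℝ) (u := fun i => WithLp.toLp 2 (u i))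
    (v := fun i => WithLp.toLp 2 (v i)) (fun i j => by simpa only [hinner] using h i j)
    (WithLp.toLp 2 w)
  refine ⟨w'.ofLp, ?_, fun i => by simpa only [hinner] using hw'v i⟩
  calc sqNorm w'.ofLp = ‖w'‖ ^ 2 := hsq w'
    _ ≤ ‖WithLp.toLp 2 w‖ ^ 2 := by gcongr
    _ = sqNorm w := (hsq _).symm

theorem exists_mulVec_eq_of_gram_eq (h : ∀ i j, v i ⬝ᵥ v j = u i ⬝ᵥ u j) {p : ℕ}
    (A : Matrix (Fin p) (Fin n) ℝ) :
    ∃ A' : Matrix (Fin p) (Fin n') ℝ, sqFrob A' ≤ sqFrob A ∧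
      ∀ i, A'.mulVec (v i) = A.mulVec (u i) := by
  choose A' hle hA' using fun k => exists_dotProduct_eq_of_gram_eq h (A k)
  exact ⟨Matrix.of A', Finset.sum_le_sum fun k _ => hle k, fun i => funext fun k => hA' k i⟩

end GramDotProduct

namespace Network

variable {a : ℝ} {d n n' e : ℕ} {ns ns' : List ℕ}

theorem normSq_nonneg (V : Network d ns e) : 0 ≤ V.normSq := by
  induction V with
  | output A b => exact add_nonneg (sqFrob_nonneg _) (sqNorm_nonneg _)
  | hidden A b V ih => exact add_nonneg (add_nonneg (sqFrob_nonneg _) (sqNorm_nonneg _)) ih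

/-- The map `x ↦ σ_a(A x + b)` computed by one hidden layer. -/
noncomputable def layer (a : ℝ) (A : Matrix (Fin n) (Fin d) ℝ) (b : Fin n → ℝ) (x : Fin d → ℝ) :
    Fin n → ℝ :=
  fun i => homAct a ((A.mulVec x + b) i)

theorem eval_hidden (A : Matrix (Fin n) (Fin d) ℝ) (b : Fin n → ℝ) (V : Network n ns e)
    (x : Fin d → ℝ) : (hidden A b V).eval a x = V.eval a (layer a A b x) := rfl

theorem continuous_layer (a : ℝ) (A : Matrix (Fin n) (Fin d) ℝ) (b : Fin n → ℝ) :
    Continuous (layer a A b) :=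
  continuous_pi fun i => (continuous_homAct a).comp <| (continuous_apply i).comp <|
    (continuous_const.matrix_mulVec continuous_id).add continuous_const

theorem continuous_eval (a : ℝ) (V : Network d ns e) : Continuous (V.eval a) := by
  induction V with
  | output A b => exact (continuous_const.matrix_mulVec continuous_id).add continuous_const
  | hidden A b V ih => exact ih.comp (continuous_layer a A b)

theorem layer_rescale (A : Matrix (Fin n) (Fin d) ℝ) (b : Fin n → ℝ) (s : Fin n' → Fin n)
    {r : Fin n' → ℝ} (hr : ∀ j, 0 ≤ r j) (x : Fin d → ℝ) (j : Fin n') :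
    layer a (Matrix.of fun j => r j • A (s j)) (fun j => r j * b (s j)) x j =
      r j * layer a A b x (s j) := by
  simp only [layer, ← homAct_mul_of_nonneg a (hr j), Pi.add_apply, Matrix.mulVec, Matrix.of_apply,
    smul_dotProduct, smul_eq_mul, mul_add]

/-- The network that applies the nonlinearity to the outputs of `V` and feeds them to `W`. -/
def stack {ns' : List ℕ} : {d n e : ℕ} → {ns : List ℕ} → Network d ns n → Network n ns' e →
    Network d (ns ++ n :: ns') e
  | _, _, _, _, output A b, W => hidden A b W
  | _, _, _, _, hidden A b V, W => hidden A b (V.stack W)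

theorem eval_stack (V : Network d ns n) (W : Network n ns' e) (x : Fin d → ℝ) :
    (V.stack W).eval a x = W.eval a fun i => homAct a (V.eval a x i) := by
  induction V with
  | output A b => rfl
  | hidden A b _ ih => exact ih W _

theorem normSq_stack (V : Network d ns n) (W : Network n ns' e) :
    (V.stack W).normSq = V.normSq + W.normSq := by
  induction V with
  | output A b => rfl
  | hidden A b _ ih => simp only [stack, normSq, ih W, add_assoc]

theorem exists_eval_eq_mulVec_eval_add (a : ℝ) (V : Network d ns n) (M : Matrix (Fin e) (Fin n) ℝ)
    (c : Fin e → ℝ) :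
    ∃ V' : Network d ns e, ∀ x, V'.eval a x = M.mulVec (V.eval a x) + c := by
  induction V with
  | output A b =>
    refine ⟨output (M * A) (M.mulVec b + c), fun x => ?_⟩
    simp only [eval, Matrix.mulVec_add, Matrix.mulVec_mulVec, add_assoc]
  | hidden A b V ih =>
    obtain ⟨V', hV'⟩ := ih M
    exact ⟨hidden A b V', fun x => hV' _⟩

theorem exists_eval_eq_eval_mulVec_add (a : ℝ) (V : Network n ns e) (M : Matrix (Fin n) (Fin d) ℝ)
    (c : Fin n → ℝ) :
    ∃ V' : Network d ns e, ∀ x, V'.eval a x = V.eval a (M.mulVec x + c) := by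
  cases V with
  | output A b =>
    refine ⟨output (A * M) (A.mulVec c + b), fun x => ?_⟩
    simp only [eval, Matrix.mulVec_add, Matrix.mulVec_mulVec, add_assoc]
  | hidden A b V =>
    refine ⟨hidden (A * M) (A.mulVec c + b) V, fun x => ?_⟩
    simp only [eval, Matrix.mulVec_add, Matrix.mulVec_mulVec, add_assoc]

theorem exists_eval_eq_of_gram_eq (a : ℝ) {ι : Type*} {u : ι → Fin n → ℝ} {v : ι → Fin n' → ℝ}
    (h : ∀ i j, v i ⬝ᵥ v j = u i ⬝ᵥ u j) (V : Network n ns e) :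
    ∃ V' : Network n' ns e, V'.normSq ≤ V.normSq ∧ ∀ i, V'.eval a (v i) = V.eval a (u i) := by
  cases V with
  | output A b =>
    obtain ⟨A', hle, hA'⟩ := exists_mulVec_eq_of_gram_eq h A
    refine ⟨output A' b, ?_, fun i => ?_⟩
    · simp only [normSq]; gcongr
    · simp only [eval, hA']
  | hidden A b V =>
    obtain ⟨A', hle, hA'⟩ := exists_mulVec_eq_of_gram_eq h A
    refine ⟨hidden A' b V, ?_, fun i => ?_⟩
    · simp only [normSq]; gcongr
    · simp only [eval, hA']

theorem exists_narrow_layer (a : ℝ) {ι : Type*} [Fintype ι] (A : Matrix (Fin n) (Fin d) ℝ)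
    (b : Fin n → ℝ) (x : ι → Fin d → ℝ) :
    ∃ m ≤ Fintype.card ι * Fintype.card ι + 1,
      ∃ (A' : Matrix (Fin m) (Fin d) ℝ) (b' : Fin m → ℝ),
        sqFrob A' + sqNorm b' = sqFrob A + sqNorm b ∧
        ∀ i j, layer a A' b' (x i) ⬝ᵥ layer a A' b' (x j) =
          layer a A b (x i) ⬝ᵥ layer a A b (x j) := by
  let invariants : Fin n → (ι × ι → ℝ) × ℝ := fun l =>
    (fun p => layer a A b (x p.1) l * layer a A b (x p.2) l, sqNorm (A l) + b l ^ 2)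
  obtain ⟨m, hm, s, c, hc, hsum⟩ := exists_conic_combination_le_finrank (𝕜 := ℝ) invariants
  have hgram : ∀ i j, ∑ l, c l * (layer a A b (x i) (s l) * layer a A b (x j) (s l)) =
      layer a A b (x i) ⬝ᵥ layer a A b (x j) := fun i j => by
    simpa [invariants, Prod.fst_sum, dotProduct] using congrFun (congrArg Prod.fst hsum) (i, j)
  have hcost : ∑ l, c l * (sqNorm (A (s l)) + b (s l) ^ 2) = sqFrob A + sqNorm b := by
    rw [sqFrob_eq_sum_sqNorm, sqNorm, ← Finset.sum_add_distrib]
    simpa [invariants, Prod.snd_sum] using congrArg Prod.snd hsum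
  refine ⟨m, by simpa using hm, Matrix.of fun l => √(c l) • A (s l), fun l => √(c l) * b (s l),
    ?_, fun i j => ?_⟩
  · rw [← hcost, sqFrob_eq_sum_sqNorm, sqNorm, ← Finset.sum_add_distrib]
    refine Finset.sum_congr rfl fun l _ => ?_
    change sqNorm (√(c l) • (A (s l) : Fin d → ℝ)) + (√(c l) * b (s l)) ^ 2 = _
    rw [sqNorm_smul, mul_pow, Real.sq_sqrt (hc l), mul_add]
  · rw [← hgram]
    refine Finset.sum_congr rfl fun l _ => ?_
    rw [layer_rescale A b s (fun l => Real.sqrt_nonneg (c l)),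
      layer_rescale A b s (fun l => Real.sqrt_nonneg (c l)), mul_mul_mul_comm,
      Real.mul_self_sqrt (hc l)]

theorem exists_narrow_eval_eq (a : ℝ) {ι : Type*} [Fintype ι] (V : Network d ns e)
    (x : ι → Fin d → ℝ) :
    ∃ (ns' : List ℕ) (V' : Network d ns' e), ns'.length = ns.length ∧
      (∀ n ∈ ns', n ≤ Fintype.card ι * Fintype.card ι + 1) ∧ V'.normSq ≤ V.normSq ∧
      ∀ i, V'.eval a (x i) = V.eval a (x i) := by
  induction V with
  | output A b => exact ⟨[], output A b, rfl, by simp, le_rfl, fun _ => rfl⟩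
  | hidden A b V ih =>
    obtain ⟨m, hm, A', b', hcost, hgram⟩ := exists_narrow_layer a A b x
    obtain ⟨ns₁, V₁, hlen, hns₁, hV₁, hV₁x⟩ := ih fun i => layer a A b (x i)
    obtain ⟨V₂, hV₂, hV₂x⟩ := V₁.exists_eval_eq_of_gram_eq a hgram
    refine ⟨m :: ns₁, hidden A' b' V₂, by simp [hlen], by simpa using ⟨hm, hns₁⟩, ?_, fun i => ?_⟩
    · simp only [normSq]
      linarith
    · simp only [eval_hidden, hV₂x, hV₁x]

end Network

section ZeroExtension

variable {ι κ : Type*} [Fintype ι] [Fintype κ] {s : ι → κ}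

theorem sum_apply_extend_zero (hs : s.Injective) {M : Type*} [Zero M] (φ : M → ℝ) (hφ : φ 0 = 0)
    (v : ι → M) : ∑ j, φ (Function.extend s v 0 j) = ∑ i, φ (v i) := by
  refine (Fintype.sum_of_injective s hs _ _ (fun j hj => ?_) fun i => ?_).symm
  · rw [Function.extend_apply' _ _ _ hj, Pi.zero_apply, hφ]
  · rw [hs.extend_apply]

theorem extend_zero_dotProduct_extend_zero (hs : s.Injective) (v w : ι → ℝ) :
    Function.extend s v 0 ⬝ᵥ Function.extend s w 0 = v ⬝ᵥ w := by
  refine (Fintype.sum_of_injective s hs _ _ (fun j hj => ?_) fun i => ?_).symm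
  · rw [Function.extend_apply' _ _ _ hj, Pi.zero_apply, zero_mul]
  · rw [hs.extend_apply, hs.extend_apply]

theorem sqNorm_extend_zero {n n' : ℕ} {s : Fin n → Fin n'} (hs : s.Injective) (v : Fin n → ℝ) :
    sqNorm (Function.extend s v 0) = sqNorm v :=
  sum_apply_extend_zero hs (· ^ 2) (zero_pow two_ne_zero) v

theorem sqFrob_extend_zero {d n n' : ℕ} {s : Fin n → Fin n'} (hs : s.Injective)
    (A : Matrix (Fin n) (Fin d) ℝ) : sqFrob (Matrix.of (Function.extend s A 0)) = sqFrob A :=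
  sum_apply_extend_zero hs sqNorm (sqNorm_zero d) A

end ZeroExtension

namespace Network

variable {a : ℝ} {d n n' e : ℕ} {ns ns' : List ℕ}

theorem layer_extend_zero {s : Fin n → Fin n'} (hs : s.Injective) (A : Matrix (Fin n) (Fin d) ℝ)
    (b : Fin n → ℝ) (x : Fin d → ℝ) :
    layer a (Matrix.of (Function.extend s A 0)) (Function.extend s b 0) x =
      Function.extend s (layer a A b x) 0 := by
  ext j
  change homAct a (Function.extend s A 0 j ⬝ᵥ x + Function.extend s b 0 j) = _
  by_cases hj : ∃ i, s i = j
  · obtain ⟨i, rfl⟩ := hj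
    have hrow : Function.extend s A 0 (s i) = A i := hs.extend_apply A 0 i
    rw [hrow, hs.extend_apply, hs.extend_apply]
    rfl
  · have hrow : Function.extend s A 0 j = (0 : Fin d → ℝ) := Function.extend_apply' _ _ _ hj
    rw [hrow, Function.extend_apply' _ _ _ hj, Function.extend_apply' _ _ _ hj, zero_dotProduct]
    simp only [Pi.zero_apply, add_zero, homAct_zero]

theorem exists_wide_eval_eq (a : ℝ) (V : Network d ns e)
    (h : List.Forall₂ (· ≤ ·) ns ns') :
    ∃ V' : Network d ns' e, V'.normSq ≤ V.normSq ∧ ∀ x, V'.eval a x = V.eval a x := by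
  induction V generalizing ns' with
  | output A b =>
    cases h
    exact ⟨output A b, le_rfl, fun _ => rfl⟩
  | hidden A b V ih =>
    cases h with
    | cons hn h =>
      have hs := Fin.castLE_injective hn
      obtain ⟨V₁, hV₁, hV₁x⟩ := ih h
      obtain ⟨V₂, hV₂, hV₂x⟩ := V₁.exists_eval_eq_of_gram_eq a
        (u := fun x => x) fun v w => extend_zero_dotProduct_extend_zero hs v w
      refine ⟨hidden (Matrix.of (Function.extend (Fin.castLE hn) A 0))
        (Function.extend (Fin.castLE hn) b 0) V₂, ?_, fun x => ?_⟩
      · simp only [normSq, sqFrob_extend_zero hs, sqNorm_extend_zero hs]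
        linarith
      · rw [eval_hidden, layer_extend_zero hs, hV₂x, hV₁x, eval_hidden]

end Network

section PiecewiseLinear

theorem IsPolyhedron.isClosed {d : ℕ} {P : Set (Fin d → ℝ)} (hP : IsPolyhedron P) :
    IsClosed P := by
  obtain ⟨r, φ, c, rfl⟩ := hP
  simp only [Set.ofPred_forall]
  exact isClosed_iInter fun j =>
    isClosed_le (φ j).continuous_of_finiteDimensional continuous_const

theorem IsFPLF.continuous {d e : ℕ} {f : (Fin d → ℝ) → (Fin e → ℝ)} (hf : IsFPLF f) :
    Continuous f := by
  obtain ⟨r, P, hP, hcover, hA⟩ := hf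
  refine (locallyFinite_of_finite P).continuous hcover (fun i => (hP i).isClosed) fun i => ?_
  obtain ⟨A, hA⟩ := hA i
  exact A.continuous_of_finiteDimensional.continuousOn.congr hA

theorem IsFPLF.exists_continuous_selection {d e : ℕ} {f : (Fin d → ℝ) → (Fin e → ℝ)}
    (hf : IsFPLF f) : ∃ (r : ℕ) (A : Fin r → (Fin d → ℝ) →ᵃ[ℝ] (Fin e → ℝ)),
      ∀ x, ∃ i, f x = A i x := by
  obtain ⟨r, P, -, hcover, hA⟩ := hf
  choose A hA using hA
  refine ⟨r, A, fun x => ?_⟩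
  obtain ⟨i, hi⟩ := Set.mem_iUnion.1 (hcover.ge (Set.mem_univ x))
  exact ⟨i, hA i hi⟩

theorem IsFPLF.mem_latticeClosure {d e : ℕ} {f : (Fin d → ℝ) → (Fin e → ℝ)} (hf : IsFPLF f)
    (j : Fin e) :
    (fun x => f x j) ∈
      latticeClosure (Set.range fun φ : (Fin d → ℝ) →ᵃ[ℝ] ℝ => (φ : (Fin d → ℝ) → ℝ)) := by
  obtain ⟨r, A, hA⟩ := hf.exists_continuous_selection
  refine latticeClosure_mono (Set.range_comp_subset_range
    (fun i => (LinearMap.proj (R := ℝ) j).toAffineMap.comp (A i)) _) ?_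
  exact mem_latticeClosure_of_continuous_selection ((continuous_apply j).comp hf.continuous)
    fun x => (hA x).imp fun i hi => congrFun hi j

theorem isFPLF_id (d : ℕ) : IsFPLF (id : (Fin d → ℝ) → (Fin d → ℝ)) :=
  ⟨1, fun _ => Set.univ, fun _ => ⟨0, fun i => i.elim0, fun i => i.elim0, by simp⟩,
    Set.iUnion_const _, fun _ => ⟨AffineMap.id ℝ _, fun _ _ => rfl⟩⟩

theorem exists_rankBN_factorization {d e k : ℕ} {Ω : Set (Fin d → ℝ)}
    {f : (Fin d → ℝ) → (Fin e → ℝ)} (hf : IsFPLF f) (hk : rankBN Ω f = k) :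
    ∃ (g : (Fin d → ℝ) → (Fin k → ℝ)) (h : (Fin k → ℝ) → (Fin e → ℝ)),
      IsFPLF g ∧ IsFPLF h ∧ Set.EqOn f (h ∘ g) Ω := by
  subst hk
  exact Nat.sInf_mem (s := {k | ∃ (g : (Fin d → ℝ) → (Fin k → ℝ)) (h : (Fin k → ℝ) → (Fin e → ℝ)),
    IsFPLF g ∧ IsFPLF h ∧ Set.EqOn f (h ∘ g) Ω}) ⟨d, id, f, isFPLF_id d, hf, fun _ _ => rfl⟩

end PiecewiseLinear

theorem exists_add_nonneg_of_isBounded {d n : ℕ} {Ω : Set (Fin d → ℝ)}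
    (hΩ : Bornology.IsBounded Ω) {g : (Fin d → ℝ) → (Fin n → ℝ)} (hg : Continuous g) :
    ∃ B : ℝ, ∀ x ∈ Ω, ∀ i, 0 ≤ g x i + B := by
  obtain ⟨B, hB⟩ := hΩ.isCompact_closure.exists_bound_of_continuousOn hg.continuousOn
  refine ⟨B, fun x hx i => ?_⟩
  have habs : |g x i| ≤ B := (norm_le_pi_norm (g x) i).trans (hB x (subset_closure hx))
  linarith [neg_abs_le (g x i)]

namespace Network

section Readout

variable {a : ℝ} {d n e : ℕ} {ns : List ℕ} {Ω : Set (Fin d → ℝ)}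

/-- The functions on `Ω` that are affine in the outputs of `V`, that is, those obtained by changing
only the last layer of `V`. -/
def readout (a : ℝ) (Ω : Set (Fin d → ℝ)) (V : Network d ns n) : Submodule ℝ (Ω → ℝ) :=
  Submodule.span ℝ (insert 1 (Set.range fun i (x : Ω) => V.eval a x i))

theorem one_mem_readout (V : Network d ns n) : 1 ∈ V.readout a Ω :=
  Submodule.subset_span (Set.mem_insert _ _)

theorem eval_mem_readout (V : Network d ns n) (i : Fin n) :
    (fun x : Ω => V.eval a x i) ∈ V.readout a Ω :=
  Submodule.subset_span (Set.mem_insert_of_mem _ ⟨i, rfl⟩)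

theorem readout_le {V : Network d ns n} {S : Submodule ℝ (Ω → ℝ)} (hone : 1 ∈ S)
    (heval : ∀ i, (fun x : Ω => V.eval a x i) ∈ S) : V.readout a Ω ≤ S :=
  Submodule.span_le.2 (Set.insert_subset hone (Set.range_subset_iff.2 heval))

theorem exists_eq_dotProduct_eval_add {V : Network d ns n} {φ : Ω → ℝ} (hφ : φ ∈ V.readout a Ω) :
    ∃ (w : Fin n → ℝ) (c : ℝ), ∀ x, φ x = w ⬝ᵥ V.eval a x + c := by
  obtain ⟨c, ψ, hψ, rfl⟩ := Submodule.mem_span_insert.1 hφ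
  obtain ⟨w, rfl⟩ := (Submodule.mem_span_range_iff_exists_fun ℝ).1 hψ
  exact ⟨w, c, fun x => by simp [dotProduct, add_comm]⟩

theorem exists_eval_eq_of_mem_readout {V : Network d ns n} {φ : Fin e → Ω → ℝ}
    (hφ : ∀ j, φ j ∈ V.readout a Ω) :
    ∃ V' : Network d ns e, ∀ (x : Ω) j, V'.eval a x j = φ j x := by
  choose M c hM using fun j => exists_eq_dotProduct_eval_add (hφ j)
  obtain ⟨V', hV'⟩ := V.exists_eval_eq_mulVec_eval_add a (Matrix.of M) c
  exact ⟨V', fun x j => by rw [hV', hM]; rfl⟩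

theorem affineMap_mem_readout (φ : (Fin d → ℝ) →ᵃ[ℝ] ℝ) :
    (fun x : Ω => φ x) ∈ (output (1 : Matrix (Fin d) (Fin d) ℝ) 0).readout a Ω := by
  have hφ : (fun x : Ω => φ x) =
      φ 0 • (1 : Ω → ℝ) + ∑ i, (φ.linear fun j => if i = j then 1 else 0) •
        fun x : Ω => (output (1 : Matrix (Fin d) (Fin d) ℝ) 0).eval a x i := by
    ext x
    rw [φ.decomp]
    simp [eval, LinearMap.pi_apply_eq_sum_univ φ.linear x.1, mul_comm, add_comm]
  rw [hφ]
  exact add_mem (Submodule.smul_mem _ _ (one_mem_readout _))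
    (Submodule.sum_mem _ fun i _ => Submodule.smul_mem _ _ (eval_mem_readout _ i))

/-- One more hidden layer, with the activation applied to `φ - ψ` and to the outputs of `V` shifted
into the nonnegative orthant, where the activation is the identity. -/
theorem exists_readout_le_sup_mem (ha : a ≠ 1) (hΩ : Bornology.IsBounded Ω) (V : Network d ns n)
    {φ ψ : Ω → ℝ} (hφ : φ ∈ V.readout a Ω) (hψ : ψ ∈ V.readout a Ω) :
    ∃ (n' : ℕ) (ns' : List ℕ) (V' : Network d ns' n'),
      V.readout a Ω ≤ V'.readout a Ω ∧ φ ⊔ ψ ∈ V'.readout a Ω := by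
  obtain ⟨B, hB⟩ := exists_add_nonneg_of_isBounded hΩ (V.continuous_eval a)
  let shifted : Fin n → Ω → ℝ := fun i => (fun x : Ω => V.eval a x i) + B • 1
  have hmem : ∀ j, Fin.cons (α := fun _ => Ω → ℝ) (φ - ψ) shifted j ∈ V.readout a Ω :=
    Fin.cases (sub_mem hφ hψ) fun i =>
      add_mem (eval_mem_readout V i) (Submodule.smul_mem _ B (one_mem_readout V))
  obtain ⟨U, hU⟩ := exists_eval_eq_of_mem_readout hmem
  let V' := U.stack (output (1 : Matrix (Fin (n + 1)) (Fin (n + 1)) ℝ) 0)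
  have hV' : ∀ (x : Ω) j, V'.eval a x j = homAct a (U.eval a x j) := fun x j => by
    simp [V', eval_stack, eval]
  have hact : (fun x => homAct a ((φ - ψ) x)) ∈ V'.readout a Ω := by
    simpa only [hV', hU, Fin.cons_zero] using eval_mem_readout (a := a) (Ω := Ω) V' 0
  have hle : V.readout a Ω ≤ V'.readout a Ω := readout_le (one_mem_readout V') fun i => by
    have hshift : (fun x : Ω => V.eval a x i) = (fun x : Ω => V'.eval a x i.succ) - B • 1 := by
      ext x
      have hx : homAct a (shifted i x) = shifted i x :=
        homAct_of_nonneg a (by simpa [shifted] using hB x x.2 i)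
      simp only [Pi.sub_apply, hV', hU, Fin.cons_succ, hx]
      simp [shifted]
    rw [hshift]
    exact sub_mem (eval_mem_readout V' _) (Submodule.smul_mem _ B (one_mem_readout V'))
  have hsup : φ ⊔ ψ = ψ + (1 - a)⁻¹ • ((fun x => homAct a ((φ - ψ) x)) - a • (φ - ψ)) :=
    funext fun x => sup_eq_add_homAct ha (φ x) (ψ x)
  rw [hsup]
  exact ⟨_, _, V', hle, add_mem (hle hψ) (Submodule.smul_mem _ _
    (sub_mem hact (Submodule.smul_mem _ _ (hle (sub_mem hφ hψ)))))⟩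

end Readout

section Adjoinable

variable {a : ℝ} {d : ℕ} {Ω : Set (Fin d → ℝ)}

/-- The functions whose restriction to `Ω` can be added to the readout of any network that retains
the input coordinates, without losing what that network already computes. Quantifying over all such
networks lets functions be adjoined one after the other. -/
def adjoinable (a : ℝ) (Ω : Set (Fin d → ℝ)) : Set ((Fin d → ℝ) → ℝ) :=
  {φ | ∀ ⦃n : ℕ⦄ ⦃ns : List ℕ⦄ (V : Network d ns n),
    (output (1 : Matrix (Fin d) (Fin d) ℝ) 0).readout a Ω ≤ V.readout a Ω →
    ∃ (n' : ℕ) (ns' : List ℕ) (V' : Network d ns' n'),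
      V.readout a Ω ≤ V'.readout a Ω ∧ Ω.domRestrict φ ∈ V'.readout a Ω}

theorem affineMap_mem_adjoinable (φ : (Fin d → ℝ) →ᵃ[ℝ] ℝ) : ⇑φ ∈ adjoinable a Ω :=
  fun n ns V hV => ⟨n, ns, V, le_rfl, hV (affineMap_mem_readout φ)⟩

theorem isSublattice_adjoinable (ha : a ≠ 1) (hΩ : Bornology.IsBounded Ω) :
    IsSublattice (adjoinable a Ω) := by
  have hboth : ∀ φ ∈ adjoinable a Ω, ∀ ψ ∈ adjoinable a Ω, ∀ ⦃n ns⦄ (V : Network d ns n),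
      (output (1 : Matrix (Fin d) (Fin d) ℝ) 0).readout a Ω ≤ V.readout a Ω →
      ∃ (n' : ℕ) (ns' : List ℕ) (V' : Network d ns' n'), V.readout a Ω ≤ V'.readout a Ω ∧
        Ω.domRestrict φ ⊔ Ω.domRestrict ψ ∈ V'.readout a Ω ∧
        Ω.domRestrict φ ⊓ Ω.domRestrict ψ ∈ V'.readout a Ω := by
    intro φ hφ ψ hψ n ns V hV
    obtain ⟨_, _, V₁, h₁, hφ₁⟩ := hφ V hV
    obtain ⟨_, _, V₂, h₂, hψ₂⟩ := hψ V₁ (hV.trans h₁)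
    obtain ⟨_, _, V₃, h₃, hsup⟩ := V₂.exists_readout_le_sup_mem ha hΩ (h₂ hφ₁) hψ₂
    refine ⟨_, _, V₃, h₁.trans (h₂.trans h₃), hsup, ?_⟩
    rw [eq_sub_of_add_eq (inf_add_sup (Ω.domRestrict φ) (Ω.domRestrict ψ))]
    exact sub_mem (add_mem (h₃ (h₂ hφ₁)) (h₃ hψ₂)) hsup
  constructor
  · intro φ hφ ψ hψ n ns V hV
    obtain ⟨_, _, V', h, hsup, -⟩ := hboth φ hφ ψ hψ V hV
    exact ⟨_, _, V', h, hsup⟩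
  · intro φ hφ ψ hψ n ns V hV
    obtain ⟨_, _, V', h, -, hinf⟩ := hboth φ hφ ψ hψ V hV
    exact ⟨_, _, V', h, hinf⟩

theorem exists_eval_eq_of_mem_adjoinable {e : ℕ} {f : (Fin d → ℝ) → (Fin e → ℝ)}
    (hf : ∀ j, (fun x => f x j) ∈ adjoinable a Ω) :
    ∃ (ns : List ℕ) (V : Network d ns e), Set.EqOn (V.eval a) f Ω := by
  have hjoint : ∀ s : Finset (Fin e), ∃ (n : ℕ) (ns : List ℕ) (V : Network d ns n),
      (output (1 : Matrix (Fin d) (Fin d) ℝ) 0).readout a Ω ≤ V.readout a Ω ∧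
      ∀ j ∈ s, (fun x : Ω => f x j) ∈ V.readout a Ω := by
    intro s
    induction s using Finset.induction_on with
    | empty => exact ⟨_, _, output 1 0, le_rfl, by simp⟩
    | insert j s _ ih =>
      obtain ⟨_, _, V, hV, hs⟩ := ih
      obtain ⟨_, _, V', h, hj⟩ := hf j V hV
      exact ⟨_, _, V', hV.trans h,
        (Finset.forall_mem_insert _ _ _).2 ⟨hj, fun i hi => h (hs i hi)⟩⟩
  obtain ⟨_, ns, V, -, hV⟩ := hjoint Finset.univ
  obtain ⟨V', hV'⟩ := exists_eval_eq_of_mem_readout fun j => hV j (Finset.mem_univ j)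
  exact ⟨ns, V', fun x hx => funext (hV' ⟨x, hx⟩)⟩

end Adjoinable

end Network

theorem IsFPLF.exists_eval_eqOn {a : ℝ} (ha : a ≠ 1) {d e : ℕ} {Ω : Set (Fin d → ℝ)}
    (hΩ : Bornology.IsBounded Ω) {f : (Fin d → ℝ) → (Fin e → ℝ)} (hf : IsFPLF f) :
    ∃ (ns : List ℕ) (V : Network d ns e), Set.EqOn (V.eval a) f Ω :=
  Network.exists_eval_eq_of_mem_adjoinable fun j =>
    latticeClosure_min (Set.range_subset_iff.2 Network.affineMap_mem_adjoinable)
      (Network.isSublattice_adjoinable ha hΩ) (hf.mem_latticeClosure j)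

section RepresentationCost

variable {a : ℝ} {d k e L m : ℕ} {r : ℝ} {Ω : Set (Fin d → ℝ)} {f : (Fin d → ℝ) → (Fin e → ℝ)}

theorem Network.exists_prepend_identity (a : ℝ) {ns : List ℕ} (V : Network k ns e) (t : ℕ) :
    ∃ V' : Network k (List.replicate t k ++ ns) e, V'.normSq = t * k + V.normSq ∧
      ∀ z, (∀ i, 0 ≤ z i) → V'.eval a z = V.eval a z := by
  induction t with
  | zero => exact ⟨V, by simp, fun _ _ => rfl⟩
  | succ t ih =>
    obtain ⟨V', hcost, hV'⟩ := ih
    refine ⟨hidden 1 0 V', ?_, fun z hz => ?_⟩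
    · change sqFrob 1 + sqNorm 0 + V'.normSq = _
      rw [sqFrob_one, sqNorm_zero, hcost]
      push_cast
      ring
    · have hlayer : layer a 1 0 z = z := funext fun i => by
        simpa [layer] using homAct_of_nonneg a (hz i)
      rw [← hV' z hz, eval_hidden, hlayer]

theorem exists_bottleneck_eval_eqOn (ha : a ≠ 1) (hΩ : Bornology.IsBounded Ω)
    {g : (Fin d → ℝ) → (Fin k → ℝ)} {h : (Fin k → ℝ) → (Fin e → ℝ)} (hg : IsFPLF g)
    (hh : IsFPLF h) :
    ∃ (ns₁ ns₂ : List ℕ) (C : ℝ≥0), ∀ t : ℕ,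
      ∃ V : Network d (ns₁ ++ k :: (List.replicate t k ++ ns₂)) e,
        Set.EqOn (V.eval a) (h ∘ g) Ω ∧ V.normSq = t * k + C := by
  obtain ⟨B, hB⟩ := exists_add_nonneg_of_isBounded hΩ hg.continuous
  have hgΩ : Bornology.IsBounded (g '' Ω) :=
    (hΩ.isCompact_closure.image hg.continuous).isBounded.subset (Set.image_mono subset_closure)
  obtain ⟨ns₁, U, hU⟩ := hg.exists_eval_eqOn ha hΩ
  obtain ⟨U₁, hU₁⟩ := U.exists_eval_eq_mulVec_eval_add a (1 : Matrix (Fin k) (Fin k) ℝ) fun _ => B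
  obtain ⟨ns₂, V, hV⟩ := hh.exists_eval_eqOn ha hgΩ
  obtain ⟨V₁, hV₁⟩ := V.exists_eval_eq_eval_mulVec_add a (1 : Matrix (Fin k) (Fin k) ℝ) fun _ => -B
  refine ⟨ns₁, ns₂, (U₁.normSq + V₁.normSq).toNNReal, fun t => ?_⟩
  obtain ⟨V₂, hcost, hV₂⟩ := V₁.exists_prepend_identity a t
  refine ⟨U₁.stack V₂, fun x hx => ?_, ?_⟩
  · have hshift : U₁.eval a x = g x + fun _ => B := by rw [hU₁, hU hx, Matrix.one_mulVec]
    have hpos : ∀ i, 0 ≤ U₁.eval a x i := by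
      rw [hshift]
      exact hB x hx
    have hback : U₁.eval a x + (fun _ => -B) = g x := by
      rw [hshift]
      ext i
      exact add_neg_cancel_right _ _
    have hact : (fun i => homAct a (U₁.eval a x i)) = U₁.eval a x :=
      funext fun i => homAct_of_nonneg a (hpos i)
    rw [Network.eval_stack, hact, hV₂ _ hpos, hV₁, Matrix.one_mulVec, hback,
      hV (Set.mem_image_of_mem g hx), Function.comp_apply]
  · rw [Network.normSq_stack, hcost,
      Real.coe_toNNReal _ (add_nonneg U₁.normSq_nonneg V₁.normSq_nonneg)]
    ring

/-- `f` is represented on `Ω` by a network of depth `L`, with hidden widths at most `m` and squared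
parameter norm at most `r`. -/
def RepresentableWithin (a : ℝ) (L m : ℕ) (r : ℝ) (Ω : Set (Fin d → ℝ))
    (f : (Fin d → ℝ) → (Fin e → ℝ)) : Prop :=
  ∃ (ns : List ℕ) (V : Network d ns e), ns.length + 1 = L ∧ (∀ n ∈ ns, n ≤ m) ∧
    Set.EqOn (V.eval a) f Ω ∧ V.normSq ≤ r

theorem RepresentableWithin.mono {m' : ℕ} {r' : ℝ} (h : RepresentableWithin a L m r Ω f)
    (hm : m ≤ m') (hr : r ≤ r') : RepresentableWithin a L m' r' Ω f := by
  obtain ⟨ns, V, hL, hns, hV, hcost⟩ := h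
  exact ⟨ns, V, hL, fun n hn => (hns n hn).trans hm, hV, hcost.trans hr⟩

theorem exists_representableWithin_of_large_depth (ha : a ≠ 1) (hΩ : Bornology.IsBounded Ω)
    (hf : IsFPLF f) (hk : rankBN Ω f = k) :
    ∃ (C : ℝ≥0) (L₀ m : ℕ), ∀ L ≥ L₀, RepresentableWithin a L m (k * L + C) Ω f := by
  obtain ⟨g, h, hg, hh, hfgh⟩ := exists_rankBN_factorization hf hk
  obtain ⟨ns₁, ns₂, C, H⟩ := exists_bottleneck_eval_eqOn ha hΩ hg hh
  refine ⟨C, ns₁.length + ns₂.length + 2, ns₁.sum + k + ns₂.sum, fun L hL => ?_⟩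
  obtain ⟨t, rfl⟩ := Nat.exists_eq_add_of_le hL
  obtain ⟨V, hV, hcost⟩ := H t
  refine ⟨_, V, ?_, fun n hn => ?_, hV.trans hfgh.symm, ?_⟩
  · simp only [List.length_append, List.length_cons, List.length_replicate]
    ring
  · have hle : ∀ {l : List ℕ}, n ∈ l → n ≤ l.sum := List.le_sum_of_mem
    simp only [List.mem_append, List.mem_cons, List.mem_replicate] at hn
    rcases hn with hn | rfl | ⟨-, rfl⟩ | hn
    · exact ((hle hn).trans le_self_add).trans le_self_add
    · omega
    · omega
    · exact (hle hn).trans le_add_self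
  · rw [hcost, mul_comm]
    gcongr
    exact le_add_self

theorem exists_representableWithin_of_reprCost_ne_top (h : reprCost a L Ω f ≠ ⊤) :
    ∃ (C : ℝ≥0) (m : ℕ), RepresentableWithin a L m C Ω f := by
  simp only [reprCost, ne_eq, iInf_eq_top, not_forall] at h
  obtain ⟨ns, hL, V, hV, -⟩ := h
  exact ⟨⟨V.normSq, V.normSq_nonneg⟩, ns.sum, ns, V, hL, fun n hn => List.le_sum_of_mem hn, hV,
    le_rfl⟩

theorem exists_representableWithin (ha : a ≠ 1) (hΩ : Bornology.IsBounded Ω) (hf : IsFPLF f)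
    (hk : rankBN Ω f = k) :
    ∃ (C : ℝ≥0) (L₀ m : ℕ), ∀ L, (L₀ ≤ L ∨ reprCost a L Ω f ≠ ⊤) →
      RepresentableWithin a L m (k * L + C) Ω f := by
  obtain ⟨C₀, L₀, m₀, hlarge⟩ := exists_representableWithin_of_large_depth ha hΩ hf hk
  have hsmall : ∀ L, ∃ (C : ℝ≥0) (m : ℕ), reprCost a L Ω f ≠ ⊤ →
      RepresentableWithin a L m C Ω f := fun L => by
    by_cases h : reprCost a L Ω f = ⊤
    · exact ⟨0, 0, fun h' => absurd h h'⟩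
    · exact (exists_representableWithin_of_reprCost_ne_top h).imp fun C => Exists.imp
        fun m hm _ => hm
  choose C m hsmall using hsmall
  refine ⟨C₀ + ∑ l ∈ Finset.range L₀, C l, L₀, m₀ + ∑ l ∈ Finset.range L₀, m l, fun L hL => ?_⟩
  rcases le_or_gt L₀ L with hL₀ | hL₀
  · refine (hlarge L hL₀).mono le_self_add ?_
    gcongr
    exact le_self_add
  · have hmem := Finset.mem_range.2 hL₀
    refine (hsmall L (hL.resolve_left hL₀.not_ge)).mono
      ((Finset.single_le_sum (fun _ _ => zero_le) hmem).trans le_add_self) ?_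
    refine le_add_of_nonneg_of_le (by positivity) (NNReal.coe_le_coe.2 ?_)
    exact (Finset.single_le_sum (fun _ _ => zero_le) hmem).trans le_add_self

theorem Network.reprCost_le_normSq {ns : List ℕ} (V : Network d ns e)
    (hV : Set.EqOn (V.eval a) f Ω) :
    reprCost a (ns.length + 1) Ω f ≤ ENNReal.ofReal V.normSq :=
  iInf₂_le_of_le ns rfl (iInf₂_le V hV)

theorem ofReal_div_le_add_div {C : ℝ≥0} (hL : L ≠ 0) (hr : r ≤ k * L + C) :
    ENNReal.ofReal r / (L : ℝ≥0∞) ≤ k + C / L :=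
  calc ENNReal.ofReal r / (L : ℝ≥0∞) ≤ ENNReal.ofReal (k * L + C) / L := by gcongr
    _ = (k * L + C) / L := by
      rw [ENNReal.ofReal_add (by positivity) C.coe_nonneg, ENNReal.ofReal_mul (by positivity)]
      simp only [ENNReal.ofReal_natCast, ENNReal.ofReal_coe_nnreal]
    _ = k + C / L := by
      rw [ENNReal.add_div, ENNReal.mul_div_cancel_right (Nat.cast_ne_zero.2 hL) (by simp)]

end RepresentationCost

theorem forall₂_le_of_forall_le {m : ℕ} {l l' : List ℕ} (hlen : l.length = l'.length)
    (h : ∀ n ∈ l, n ≤ m) (h' : ∀ n ∈ l', m ≤ n) : List.Forall₂ (· ≤ ·) l l' :=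
  List.forall₂_iff_get.2 ⟨hlen, fun _ _ _ =>
    (h _ (List.get_mem _ _)).trans (h' _ (List.get_mem _ _))⟩

namespace Network.IsGlobalMin

variable {a lam : ℝ} {d e N : ℕ} {ns : List ℕ} {Ω : Set (Fin d → ℝ)} {x : Fin N → (Fin d → ℝ)}
  {f : (Fin d → ℝ) → (Fin e → ℝ)} {W : Network d ns e}

theorem normSq_le (hW : W.IsGlobalMin a lam x f) (hlam : 0 < lam) (V : Network d ns e)
    (hV : ∀ i, V.eval a (x i) = f (x i)) : W.normSq ≤ V.normSq := by
  have hfit : 0 ≤ 1 / (N : ℝ) * ∑ i, sqNorm (W.eval a (x i) - f (x i)) :=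
    mul_nonneg (by positivity) (Finset.sum_nonneg fun i _ => sqNorm_nonneg _)
  have hcoef : 0 < lam / ((ns.length + 1 : ℕ) : ℝ) := by positivity
  refine le_of_mul_le_mul_left ?_ hcoef
  calc lam / ((ns.length + 1 : ℕ) : ℝ) * W.normSq ≤ W.loss a lam x f := le_add_of_nonneg_left hfit
    _ ≤ V.loss a lam x f := hW V
    _ = lam / ((ns.length + 1 : ℕ) : ℝ) * V.normSq := by
      simp only [loss, hV, sub_self, sqNorm_zero, Finset.sum_const_zero, mul_zero, zero_add]

theorem reprCost_eval_le (hW : W.IsGlobalMin a lam x f) (hlam : 0 < lam) {ns' : List ℕ}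
    (hns : List.Forall₂ (· ≤ ·) ns' ns) (V : Network d ns' e)
    (hV : ∀ i, V.eval a (x i) = f (x i)) :
    reprCost a (ns.length + 1) Ω (W.eval a) ≤ ENNReal.ofReal V.normSq := by
  obtain ⟨V', hle, hV'⟩ := V.exists_wide_eval_eq a hns
  calc reprCost a (ns.length + 1) Ω (W.eval a) ≤ ENNReal.ofReal W.normSq :=
        W.reprCost_le_normSq fun _ _ => rfl
    _ ≤ ENNReal.ofReal V.normSq := ENNReal.ofReal_le_ofReal
        ((hW.normSq_le hlam V' fun i => (hV' _).trans (hV i)).trans hle)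

theorem reprCost_eval_le_of_wide (hW : W.IsGlobalMin a lam x f) (hlam : 0 < lam)
    (hx : ∀ i, x i ∈ Ω) (hwide : ∀ n ∈ ns, N * N + 1 ≤ n) :
    reprCost a (ns.length + 1) Ω (W.eval a) ≤ reprCost a (ns.length + 1) Ω f := by
  refine le_iInf₂ fun ns' hns' => le_iInf₂ fun V hV => ?_
  obtain ⟨ns₁, V₁, hlen, hnarrow, hle, hV₁⟩ := V.exists_narrow_eval_eq a x
  rw [Fintype.card_fin] at hnarrow
  have hns : List.Forall₂ (· ≤ ·) ns₁ ns := forall₂_le_of_forall_le (by omega) hnarrow hwide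
  exact (hW.reprCost_eval_le hlam hns V₁ fun i => (hV₁ i).trans (hV (hx i))).trans
    (ENNReal.ofReal_le_ofReal hle)

theorem reprCost_eval_le_of_costAttainedWithin (hW : W.IsGlobalMin a lam x f) (hlam : 0 < lam)
    (hx : ∀ i, x i ∈ Ω) (hatt : CostAttainedWithin a Ω f ns) :
    reprCost a (ns.length + 1) Ω (W.eval a) ≤ reprCost a (ns.length + 1) Ω f := by
  obtain ⟨ns', V, hns, hV, hcost⟩ := hatt
  rw [← hcost]
  exact hW.reprCost_eval_le hlam hns V fun i => hV (hx i)

end Network.IsGlobalMin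

theorem proposition5_general (a : ℝ) (ha : a ≠ 1) {din dout : ℕ}
    (Ω : Set (Fin din → ℝ)) (hΩ : Bornology.IsBounded Ω)
    (f : (Fin din → ℝ) → (Fin dout → ℝ)) (hf : IsFPLF f)
    (k : ℕ) (hk : rankBN Ω f = k) :
    ∃ (C : ℝ≥0) (L₀ m : ℕ), ∀ L : ℕ, 1 ≤ L → (L₀ ≤ L ∨ reprCost a L Ω f ≠ ⊤) →
      reprCost a L Ω f / (L : ℝ≥0∞) ≤ (k : ℝ≥0∞) + (C : ℝ≥0∞) / (L : ℝ≥0∞) ∧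
      ∀ (N : ℕ), 0 < N → ∀ x : Fin N → (Fin din → ℝ), (∀ i, x i ∈ Ω) →
      ∀ lam : ℝ, 0 < lam →
      ∀ ns : List ℕ, ns.length + 1 = L →
      ∀ W : Network din ns dout, W.IsGlobalMin a lam x f →
        ((∀ n ∈ ns, m ≤ n) →
          reprCost a L Ω (W.eval a) / (L : ℝ≥0∞) ≤ (k : ℝ≥0∞) + (C : ℝ≥0∞) / (L : ℝ≥0∞)) ∧
        (((∀ n ∈ ns, N * (N + 1) ≤ n) ∨ CostAttainedWithin a Ω f ns) →
          reprCost a L Ω (W.eval a) / (L : ℝ≥0∞) ≤ reprCost a L Ω f / (L : ℝ≥0∞)) := by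
  obtain ⟨C, L₀, m, H⟩ := exists_representableWithin ha hΩ hf hk
  refine ⟨C, L₀, m, fun L hL hdepth => ?_⟩
  obtain ⟨ns₀, V, rfl, hm, hV, hcost⟩ := H L hdepth
  have hbound := ofReal_div_le_add_div (Nat.one_le_iff_ne_zero.1 hL) hcost
  refine ⟨(ENNReal.div_le_div_right (V.reprCost_le_normSq hV) _).trans hbound, ?_⟩
  intro N hN x hx lam hlam ns hns W hW
  rw [← hns] at hbound ⊢
  refine ⟨fun hwide => ?_, fun h => ENNReal.div_le_div_right ?_ _⟩
  · have hle : List.Forall₂ (· ≤ ·) ns₀ ns := forall₂_le_of_forall_le (by omega) hm hwide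
    exact (ENNReal.div_le_div_right (hW.reprCost_eval_le hlam hle V fun i => hV (hx i)) _).trans
      hbound
  · rcases h with hwide | hatt
    · exact hW.reprCost_eval_le_of_wide hlam hx fun n hn => by nlinarith [hwide n hn]
    · exact hW.reprCost_eval_le_of_costAttainedWithin hlam hx hatt

theorem proposition5 (a : ℝ) (ha : -1 < a) (ha' : a < 1) {din dout : ℕ}
    (Ω : Set (Fin din → ℝ)) (hΩ : Bornology.IsBounded Ω)
    (f : (Fin din → ℝ) → (Fin dout → ℝ)) (hf : IsFPLF f)
    (k : ℕ) (hk : rankBN Ω f = k) :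
    ∃ (C : ℝ≥0) (L₀ m : ℕ), ∀ L : ℕ, 1 ≤ L → (L₀ ≤ L ∨ reprCost a L Ω f ≠ ⊤) →
      reprCost a L Ω f / (L : ℝ≥0∞) ≤ (k : ℝ≥0∞) + (C : ℝ≥0∞) / (L : ℝ≥0∞) ∧
      ∀ (N : ℕ), 0 < N → ∀ x : Fin N → (Fin din → ℝ), (∀ i, x i ∈ Ω) →
      ∀ lam : ℝ, 0 < lam →
      ∀ ns : List ℕ, ns.length + 1 = L →
      ∀ W : Network din ns dout, W.IsGlobalMin a lam x f →
        ((∀ n ∈ ns, m ≤ n) →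
          reprCost a L Ω (W.eval a) / (L : ℝ≥0∞) ≤ (k : ℝ≥0∞) + (C : ℝ≥0∞) / (L : ℝ≥0∞)) ∧
        (((∀ n ∈ ns, N * (N + 1) ≤ n) ∨ CostAttainedWithin a Ω f ns) →
          reprCost a L Ω (W.eval a) / (L : ℝ≥0∞) ≤ reprCost a L Ω f / (L : ℝ≥0∞)) :=
  proposition5_general a ha'.ne Ω hΩ f hf k hk
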